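/- Let $\varphi$ be the morphism on $\{0,1,2,3\}^*$ given by $\varphi(0)=0130$, $\varphi(1)=1021$, $\varphi(2)=102$, $\varphi(3)=013$, let $\mathbf u$ be its fixed point starting in $0$, i.e. the infinite word that has $\varphi^n(0)$ as a prefix for every $n\in\mathbb N$, and let $\lambda=2+\sqrt3$. Let $\mathcal L(\mathbf u)$ be the set of finite factors (blocks of consecutive letters) of $\mathbf u$, and $\mathcal L_n(\mathbf u)$ the set of those of length $n$. A factor $w$ is bispecial if there are at least two letters $a$ with $aw\in\mathcal L(\mathbf u)$ and at least two letters $b$ with $wb\in\mathcal L(\mathbf u)$. The frequency of a factor $w$ is $$\rho(w)=\lim_{|v|\to\infty,\ v\in\mathcal L(\mathbf u)}\frac{\#\{\text{occurrences of } w \text{ in } v\}}{|v|}.$$ Let $n\ge 1$ be an integer. Then the frequency of every factor in $\mathcal L_{n+1}(\mathbf u)$ exists, and the set $F=\{\rho(e)\mid e\in\mathcal L_{n+1}(\mathbf u)\}$ satisfies the following. 1. If $\mathcal L_n(\mathbf u)$ contains a bispecial factor, then $F$ has exactly two elements and there is an integer $k\ge 0$ such that $F$ is one of the sets $$\Bigl\{\tfrac{1}{2\lambda^{k+1}},\tfrac{\sqrt3}{2\lambda^{k+1}}\Bigr\},\quad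 \Bigl\{\tfrac{1}{2\lambda^{k+1}},\tfrac{\sqrt3-1}{2\lambda^{k+1}}\Bigr\},\quad \Bigl\{\tfrac{\sqrt3-1}{2\lambda^{k+1}},\tfrac{1}{2\lambda^{k+2}}\Bigr\}.$$ 2. If $\mathcal L_n(\mathbf u)$ contains no bispecial factor, then $F$ has exactly three elements and there is an integer $k\ge 0$ such that $F$ is one of the sets $$\Bigl\{\tfrac{\sqrt3-1}{2\lambda^{k}},\tfrac{1}{2\lambda^{k+1}},\tfrac{\sqrt3}{2\lambda^{k+1}}\Bigr\},\quad \Bigl\{\tfrac{\sqrt3}{2\lambda^{k+1}},\tfrac{1}{2\lambda^{k+1}},\tfrac{\sqrt3-1}{2\lambda^{k+1}}\Bigr\},\quad \Bigl\{\tfrac{1}{2\lambda^{k+1}},\tfrac{\sqrt3-1}{2\lambda^{k+1}},\tfrac{1}{2\lambda^{k+2}}\Bigr\}.$$ -/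

import Mathlib

open Filter Topology

namespace FactorFrequency

section General

variable {A : Type*}

/-- The factor of length `n` of the infinite word `u` that occurs at position `i`. -/
def factorAt (u : ℕ → A) (i n : ℕ) : List A :=
  (List.range n).map fun j => u (i + j)

/-- The set of all factors of length `n` of the infinite word `u`. -/
def factorsOfLength (u : ℕ → A) (n : ℕ) : Set (List A) :=
  {w | ∃ i, w = factorAt u i n}

/-- The language of the infinite word `u`: the set of all its (finite) factors. -/
def language (u : ℕ → A) : Set (List A) :=
  {w | ∃ n, w ∈ factorsOfLength u n}

/-- The set of right extensions of the word `w` in `u`. -/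
def rightExtensions (u : ℕ → A) (w : List A) : Set A :=
  {a | w ++ [a] ∈ language u}

/-- The set of left extensions of the word `w` in `u`. -/
def leftExtensions (u : ℕ → A) (w : List A) : Set A :=
  {a | a :: w ∈ language u}

/-- `w` is a right special factor of `u`. -/
def IsRightSpecial (u : ℕ → A) (w : List A) : Prop :=
  w ∈ language u ∧ 2 ≤ (rightExtensions u w).encard

/-- `w` is a left special factor of `u`. -/
def IsLeftSpecial (u : ℕ → A) (w : List A) : Prop :=
  w ∈ language u ∧ 2 ≤ (leftExtensions u w).encard

/-- `w` is a bispecial factor of `u`. -/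
def IsBispecial (u : ℕ → A) (w : List A) : Prop :=
  IsLeftSpecial u w ∧ IsRightSpecial u w

/-- The number of occurrences of `w` in the finite word `v`, that is, the number of positions of
`v` at which `w` is a prefix of the remaining suffix of `v`. -/
def occurrences [DecidableEq A] (w v : List A) : ℕ :=
  ((Finset.range v.length).filter fun i => w <+: v.drop i).card

/-- The filter on words along which frequencies are computed: `|v| → ∞` with `v` a factor of
`u`. -/
def longFactors (u : ℕ → A) : Filter (List A) :=
  comap List.length atTop ⊓ 𝓟 (language u)

/-- The frequency of `w` in `u` exists and is equal to `x`. -/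
def HasFrequency [DecidableEq A] (u : ℕ → A) (w : List A) (x : ℝ) : Prop :=
  Tendsto (fun v : List A => (occurrences w v : ℝ) / (v.length : ℝ)) (longFactors u) (𝓝 x)

/-- The frequency of `w` in `u` (a meaningful value when the defining limit exists). -/
noncomputable def frequency [DecidableEq A] (u : ℕ → A) (w : List A) : ℝ :=
  limUnder (longFactors u) fun v : List A => (occurrences w v : ℝ) / (v.length : ℝ)

/-- The set of the frequencies of all factors of length `n` of `u`. -/
noncomputable def frequencySet [DecidableEq A] (u : ℕ → A) (n : ℕ) : Set ℝ :=
  frequency u '' factorsOfLength u n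

end General

/-- The images of the letters under the morphism
`0 ↦ 0130`, `1 ↦ 1021`, `2 ↦ 102`, `3 ↦ 013`. -/
def phiLetter : Fin 4 → List (Fin 4) :=
  ![[0, 1, 3, 0], [1, 0, 2, 1], [1, 0, 2], [0, 1, 3]]

/-- The morphism `0 ↦ 0130`, `1 ↦ 1021`, `2 ↦ 102`, `3 ↦ 013` on finite words. -/
def phi (w : List (Fin 4)) : List (Fin 4) :=
  w.flatMap phiLetter

/-- The infinite word that has all the iterates `phi^n(0)` as prefixes
(see `prefix_exampleWord`). The `i`-th letter is read off from `phi^i(0)`, whose length is more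
than `i`. -/
def exampleWord (i : ℕ) : Fin 4 :=
  (phi^[i] [0]).getD i 0

theorem length_phi (w : List (Fin 4)) : 2 * w.length ≤ (phi w).length := by
  induction w with
  | nil => simp
  | cons a w ih =>
    have h : 2 ≤ (phiLetter a).length := by
      fin_cases a <;> simp [phiLetter]
    simp only [phi, List.flatMap_cons, List.length_append, List.length_cons] at ih ⊢
    omega

theorem length_iterate_phi (n : ℕ) : n < (phi^[n] [0]).length := by
  induction n with
  | zero => simp
  | succ n ih =>
    rw [Function.iterate_succ_apply']
    have := length_phi (phi^[n] [0])
    omega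

theorem phi_prefix {v w : List (Fin 4)} (h : v <+: w) : phi v <+: phi w := by
  obtain ⟨t, rfl⟩ := h
  exact ⟨phi t, by simp [phi]⟩

theorem iterate_phi_prefix_succ (n : ℕ) : phi^[n] [0] <+: phi^[n + 1] [0] := by
  induction n with
  | zero => exact ⟨[1, 3, 0], by simp [phi, phiLetter]⟩
  | succ n ih =>
    rw [Function.iterate_succ_apply', Function.iterate_succ_apply']
    exact phi_prefix ih

theorem iterate_phi_prefix {m n : ℕ} (h : m ≤ n) : phi^[m] [0] <+: phi^[n] [0] := by
  induction n, h using Nat.le_induction with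
  | base => exact List.prefix_rfl
  | succ n _ ih => exact ih.trans (iterate_phi_prefix_succ n)

/-- Every iterate `phi^n(0)` is a prefix of the word `exampleWord`. -/
theorem prefix_exampleWord (n : ℕ) :
    phi^[n] [0] = factorAt exampleWord 0 (phi^[n] [0]).length := by
  apply List.ext_getElem
  · simp [factorAt]
  · intro i h₁ h₂
    have hi := length_iterate_phi i
    simp only [factorAt, List.getElem_map, List.getElem_range, Nat.zero_add, exampleWord]
    rw [List.getD_eq_getElem _ _ hi]
    rcases le_total i n with h | h
    · exact ((iterate_phi_prefix h).getElem hi).symm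
    · exact (iterate_phi_prefix h).getElem h₁

/-- The dominant eigenvalue `2 + √3` of the incidence matrix of `phi`. -/
noncomputable def lam : ℝ := 2 + √3

end FactorFrequency

open FactorFrequency

namespace FactorFrequency

/-! Write ξ for `angle`. The word codes the rotation by ξ on the circle ℝ/2ℤ: its letters record the
parities and increments of the integer parts of the multiples of ξ. Because ξ² = 2 - 2ξ, this
rotation renormalises to itself under `phi`, so the coding is the fixed point
(`exampleWord_eq_rotationWord`).

Two factors of length m ≥ 1 agree exactly when their starting points lie, modulo 2, in the same cell
cut out by the points g - jξ with g an integer and j ≤ m (`factorAt_rotationWord_eq_iff`). By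
uniform equidistribution the frequency of a factor is its cell length divided by the circumference
2.

The cell lengths come from the three-gap theorem. If p/a and q/b are Farey neighbours around ξ, x =
aξ - p, y = q - bξ, and a, b ≤ m < a + b, then the gaps are x and y, together with x + y exactly
when m + 1 < a + b (`Neighbours`, `gapLength`). Taking m = n + 1, there are only two gap lengths
when n + 2 = a + b, and this is also exactly when some factor of length n is bispecial
(`Neighbours.exists_isBispecial`, `Neighbours.eq_add_of_isBispecial`).

Finally, the subtractive Euclidean algorithm on (x, y) is periodic up to the factor 2 - √3 = λ⁻¹,
with three states per period; these give the three shapes of each list (`exists_neighbours`). -/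

theorem length_factorAt {A : Type*} (u : ℕ → A) (i n : ℕ) : (factorAt u i n).length = n := by
  simp [factorAt]

theorem factorAt_succ {A : Type*} (u : ℕ → A) (i n : ℕ) :
    factorAt u i (n + 1) = factorAt u i n ++ [u (i + n)] := by
  simp [factorAt, List.range_succ]

theorem factorAt_add {A : Type*} (u : ℕ → A) (i m n : ℕ) :
    factorAt u i (m + n) = factorAt u i m ++ factorAt u (i + m) n := by
  simp [factorAt, List.range_add, Function.comp_def, add_assoc]

theorem factorAt_succ' {A : Type*} (u : ℕ → A) (i n : ℕ) :
    factorAt u i (n + 1) = u i :: factorAt u (i + 1) n := by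
  rw [add_comm n 1, factorAt_add]
  simp [factorAt]

theorem factorAt_eq_iff {A : Type*} (u v : ℕ → A) (i k n : ℕ) :
    factorAt u i n = factorAt v k n ↔ ∀ j < n, u (i + j) = v (k + j) := by
  simp [factorAt]

/-! ### The fixed point as a coding of a rotation -/

/-- The angle `√3 - 1` of the rotation coded by `exampleWord`. -/
noncomputable def angle : ℝ := √3 - 1

theorem angle_sq : angle ^ 2 = 2 - 2 * angle := by
  have := Real.sq_sqrt (show (0 : ℝ) ≤ 3 by norm_num)
  unfold angle
  linarith [this, (by ring : (√3 - 1) ^ 2 = √3 ^ 2 - 2 * √3 + 1)]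

theorem angle_gt : (0.732 : ℝ) < angle := by
  have : (1.732 : ℝ) < √3 := Real.lt_sqrt_of_sq_lt (by norm_num)
  unfold angle; linarith

theorem angle_lt : angle < (0.7321 : ℝ) := by
  have : √3 < (1.7321 : ℝ) := (Real.sqrt_lt' (by norm_num)).2 (by norm_num)
  unfold angle; linarith

theorem irrational_angle : Irrational angle := by
  have h : Irrational √3 := by simpa using Nat.Prime.irrational_sqrt Nat.prime_three
  simpa [angle] using h.sub_intCast 1

/-- The letter of the coded rotation for which the consecutive orbit points have integer parts
`g` and `h`. -/
def code (g h : ℤ) : Fin 4 :=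
  if Even h then (if h = g then 3 else 1) else (if h = g then 2 else 0)

theorem code_add_even (g h t : ℤ) : code (g + 2 * t) (h + 2 * t) = code g h := by
  simp [code, Int.even_add]

/-- A letter carries exactly two bits: the parity of the later integer part and the increment. -/
theorem code_inj {g h g' h' : ℤ} (hg : h = g ∨ h = g + 1) (hg' : h' = g' ∨ h' = g' + 1)
    (e : code g h = code g' h') : (Even h ↔ Even h') ∧ h - g = h' - g' := by
  unfold code at e
  split_ifs at e <;> first | exact absurd e (by decide) | exact ⟨by tauto, by omega⟩

/-- The coding of the rotation by `angle` on the circle `ℝ / 2ℤ`. -/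
noncomputable def rotationWord (i : ℕ) : Fin 4 :=
  code ⌊(i + 1 : ℝ) * angle⌋ ⌊(i + 2 : ℝ) * angle⌋

theorem floor_add_angle (z : ℝ) : ⌊z + angle⌋ = ⌊z⌋ ∨ ⌊z + angle⌋ = ⌊z⌋ + 1 := by
  have h1 := Int.floor_le z
  have h2 := Int.lt_floor_add_one z
  have h3 := angle_gt
  have h4 := angle_lt
  rcases lt_or_ge (z + angle) (⌊z⌋ + 1) with h | h
  · left; rw [Int.floor_eq_iff]; constructor <;> linarith
  · right; rw [Int.floor_eq_iff]; push_cast; constructor <;> linarith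

/-- The length of the image under `phi` of the prefix of length `N` of `rotationWord`. -/
noncomputable def imageLength (N : ℕ) : ℕ := 3 * N + ⌊(N + 1 : ℝ) * angle⌋.toNat

theorem cast_imageLength (N : ℕ) :
    (imageLength N : ℝ) = 3 * N + (⌊(N + 1 : ℝ) * angle⌋ : ℝ) := by
  have : 0 ≤ ⌊(N + 1 : ℝ) * angle⌋ := Int.floor_nonneg.2 (by
    have := angle_gt; positivity)
  have h := Int.toNat_of_nonneg this
  unfold imageLength
  push_cast
  rw [← Int.cast_natCast (⌊(N + 1 : ℝ) * angle⌋.toNat), h]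

/-- Let f be the integer part and τ the fractional part of (N + 1)ξ. The quadratic equation for ξ
turns (3N + f + j)ξ into f + 2N + 2 + τ(1 - ξ) + (j - 3)ξ. Since 0 ≤ τ < 1, the two hypotheses bound
the extreme values. -/
theorem floor_imageLength (N : ℕ) (j : ℕ) (c : ℤ) (h1 : (c : ℝ) ≤ 2 + (j - 3) * angle)
    (h2 : 2 + (j - 3) * angle + (1 - angle) ≤ c + 1) :
    ⌊((imageLength N : ℝ) + j) * angle⌋ = ⌊(N + 1 : ℝ) * angle⌋ + 2 * N + c := by
  rw [Int.floor_eq_iff, cast_imageLength]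
  set f := ⌊(N + 1 : ℝ) * angle⌋ with hf
  have h3 : (f : ℝ) ≤ (N + 1) * angle := Int.floor_le _
  have h4 : (N + 1) * angle < f + 1 := Int.lt_floor_add_one _
  have h5 := angle_gt
  have h6 := angle_lt
  have key : (3 * N + (f : ℝ) + j) * angle =
      f + 2 * N + 2 + ((N + 1) * angle - f) * (1 - angle) + (j - 3) * angle := by
    linear_combination (N + 1 : ℝ) * angle_sq
  rw [key]
  push_cast
  constructor
  · nlinarith
  · nlinarith

/-- Renormalisation step. The integer parts at five consecutive times are f + 2N + c with c = 0, 1,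
2, 2, 3, so the block depends only on the parity of f and on its length. That length is 3 plus the
increment of the integer part, and those two data are what the letter at N encodes. -/
theorem phiLetter_rotationWord (N : ℕ) :
    imageLength N ≤ imageLength (N + 1) ∧
    phiLetter (rotationWord N) =
      factorAt rotationWord (imageLength N) (imageLength (N + 1) - imageLength N) := by
  have h5 := angle_gt
  have h6 := angle_lt
  have f1 := floor_imageLength N 1 0 (by norm_num; linarith) (by norm_num; linarith)
  have f2 := floor_imageLength N 2 1 (by norm_num; linarith) (by norm_num; linarith)
  have f3 := floor_imageLength N 3 2 (by norm_num) (by norm_num; linarith)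
  have f4 := floor_imageLength N 4 2 (by norm_num; linarith) (by norm_num)
  have f5 := floor_imageLength N 5 3 (by norm_num; linarith) (by norm_num; linarith)
  have hl : imageLength (N + 1) = imageLength N + 3 +
      (⌊(N + 2 : ℝ) * angle⌋ - ⌊(N + 1 : ℝ) * angle⌋).toNat := by
    have h := floor_add_angle ((N + 1 : ℝ) * angle)
    have h0 : 0 ≤ ⌊(N + 1 : ℝ) * angle⌋ := Int.floor_nonneg.2 (by positivity)
    rw [show (N + 1 : ℝ) * angle + angle = (N + 2) * angle by ring] at h
    unfold imageLength
    push_cast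
    rw [show (N + 1 + 1 : ℝ) * angle = (N + 2) * angle by ring]
    omega
  set f := ⌊(N + 1 : ℝ) * angle⌋ with hf
  have h := floor_add_angle ((N + 1 : ℝ) * angle)
  rw [show (N + 1 : ℝ) * angle + angle = (N + 2) * angle by ring, ← hf] at h
  have l0 : rotationWord (imageLength N) = code (f + 2 * N + 0) (f + 2 * N + 1) := by
    unfold rotationWord; rw [← f1, ← f2]; norm_num
  have l1 : rotationWord (imageLength N + 1) = code (f + 2 * N + 1) (f + 2 * N + 2) := by
    unfold rotationWord; rw [← f2, ← f3]; push_cast; norm_num [add_assoc]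
  have l2 : rotationWord (imageLength N + 2) = code (f + 2 * N + 2) (f + 2 * N + 2) := by
    unfold rotationWord; nth_rewrite 1 [← f3]; rw [← f4]; push_cast; norm_num [add_assoc]
  have l3 : rotationWord (imageLength N + 3) = code (f + 2 * N + 2) (f + 2 * N + 3) := by
    unfold rotationWord; rw [← f4, ← f5]; push_cast; norm_num [add_assoc]
  have lN : rotationWord N = code f ⌊(N + 2 : ℝ) * angle⌋ := rfl
  refine ⟨by omega, ?_⟩
  rw [hl, lN]
  rcases h with h | h <;> rw [h] <;> by_cases he : Even f <;>
    simp [factorAt, List.range_succ, add_assoc, l0, l1, l2, l3, code, phiLetter,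
      Int.even_add, he, ← Int.not_even_iff_odd, show ¬ Even (3 : ℤ) by decide]

theorem phi_factorAt_rotationWord (N : ℕ) :
    phi (factorAt rotationWord 0 N) = factorAt rotationWord 0 (imageLength N) := by
  induction N with
  | zero =>
    have : ⌊angle⌋ = 0 := by
      have h5 := angle_gt
      have h6 := angle_lt
      rw [Int.floor_eq_iff]; norm_num; constructor <;> linarith
    simp [factorAt, phi, imageLength, this]
  | succ N ih =>
    obtain ⟨h1, h2⟩ := phiLetter_rotationWord N
    obtain ⟨d, hd⟩ := Nat.exists_eq_add_of_le h1
    rw [hd, Nat.add_sub_cancel_left] at h2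
    rw [factorAt_succ, hd, factorAt_add, ← ih, zero_add, zero_add, ← h2]
    simp [phi]

theorem iterate_phi_eq_factorAt_rotationWord (n : ℕ) :
    ∃ N, phi^[n] [0] = factorAt rotationWord 0 N := by
  induction n with
  | zero =>
    have h5 := angle_gt
    have h6 := angle_lt
    have h1 : ⌊angle⌋ = 0 := by
      rw [Int.floor_eq_iff]; norm_num; constructor <;> linarith
    have h2 : ⌊2 * angle⌋ = 1 := by
      rw [Int.floor_eq_iff]; norm_num; constructor <;> linarith
    exact ⟨1, by simp [factorAt, rotationWord, h1, h2, code]⟩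
  | succ n ih =>
    obtain ⟨N, hN⟩ := ih
    exact ⟨imageLength N, by rw [Function.iterate_succ_apply', hN, phi_factorAt_rotationWord]⟩

theorem exampleWord_eq_rotationWord : exampleWord = rotationWord := by
  funext i
  obtain ⟨N, hN⟩ := iterate_phi_eq_factorAt_rotationWord i
  have hi := length_iterate_phi i
  unfold exampleWord
  rw [List.getD_eq_getElem _ _ hi]
  simp [hN, factorAt]

/-- Two factors of the coded rotation agree if and only if the integer parts along the two pieces
of orbit differ by a constant even number. -/
theorem factorAt_rotationWord_eq_iff (i k n : ℕ) (hn : 1 ≤ n) :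
    factorAt rotationWord i n = factorAt rotationWord k n ↔
      ∃ t : ℤ, ∀ j : ℕ, j ≤ n →
        ⌊(i + 1 : ℝ) * angle + j * angle⌋ = ⌊(k + 1 : ℝ) * angle + 2 * t + j * angle⌋ := by
  have hrw : ∀ i j : ℕ, rotationWord (i + j) = code ⌊(i + 1 : ℝ) * angle + j * angle⌋
      ⌊(i + 1 : ℝ) * angle + (j + 1 : ℕ) * angle⌋ := by
    intro i j
    unfold rotationWord
    push_cast
    congr 2 <;> ring
  have hstep : ∀ i j : ℕ, ⌊(i + 1 : ℝ) * angle + (j + 1 : ℕ) * angle⌋ =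
        ⌊(i + 1 : ℝ) * angle + j * angle⌋ ∨ ⌊(i + 1 : ℝ) * angle + (j + 1 : ℕ) * angle⌋ =
        ⌊(i + 1 : ℝ) * angle + j * angle⌋ + 1 := by
    intro i j
    have := floor_add_angle ((i + 1 : ℝ) * angle + j * angle)
    rwa [show (i + 1 : ℝ) * angle + j * angle + angle =
      (i + 1 : ℝ) * angle + (j + 1 : ℕ) * angle by push_cast; ring] at this
  have hsh : ∀ (t : ℤ) (j : ℕ), ⌊(k + 1 : ℝ) * angle + 2 * t + j * angle⌋ =
      ⌊(k + 1 : ℝ) * angle + j * angle⌋ + 2 * t := by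
    intro t j
    rw [← Int.floor_add_intCast]
    push_cast
    congr 1; ring
  simp only [hsh]
  rw [factorAt_eq_iff]
  simp only [hrw]
  constructor
  · intro h
    have h' := fun j hj => code_inj (hstep i j) (hstep k j) (h j hj)
    have h0 := h' 0 hn
    -- `code_inj` compares parities at the end of the first step; equality of the increments carries
    -- this back to the start. An empty factor would carry no parity, whence `hn`.
    have hev : Even (⌊(i + 1 : ℝ) * angle + (0 : ℕ) * angle⌋ -
        ⌊(k + 1 : ℝ) * angle + (0 : ℕ) * angle⌋) := by
      have := Int.even_sub.2 h0.1
      rwa [show ⌊(i + 1 : ℝ) * angle + (0 + 1 : ℕ) * angle⌋ -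
        ⌊(k + 1 : ℝ) * angle + (0 + 1 : ℕ) * angle⌋ = ⌊(i + 1 : ℝ) * angle + (0 : ℕ) * angle⌋ -
        ⌊(k + 1 : ℝ) * angle + (0 : ℕ) * angle⌋ by linarith [h0.2]] at this
    obtain ⟨t, ht⟩ := hev
    refine ⟨t, fun j => ?_⟩
    induction j with
    | zero => intro _; linarith
    | succ j ih =>
      intro hj
      have h1 := ih (by omega)
      have h2 := (h' j (by omega)).2
      linarith
  · rintro ⟨t, ht⟩ j hj
    rw [ht j hj.le, ht (j + 1) hj, code_add_even]

/-! ### Uniform equidistribution -/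

/-- Intervals of length kξ have bounded discrepancy, uniformly in the starting point: for k = 1 the
sum telescopes, and other k follow by concatenating translates. -/
theorem abs_sum_floor_sub_floor_le (ξ : ℝ) (k : ℤ) :
    ∃ C : ℝ, ∀ (N : ℕ) (x : ℝ),
      |∑ i ∈ Finset.range N, ((⌊x + i * ξ⌋ : ℝ) - ⌊x + i * ξ - k * ξ⌋) - N * (k * ξ)| ≤ C := by
  have tel : ∀ (N : ℕ) (x : ℝ),
      |∑ i ∈ Finset.range N, ((⌊x + i * ξ⌋ : ℝ) - ⌊x + i * ξ - ξ⌋) - N * ξ| ≤ 1 := by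
    intro N x
    have : ∑ i ∈ Finset.range N, ((⌊x + i * ξ⌋ : ℝ) - ⌊x + i * ξ - ξ⌋) =
        ⌊x + N * ξ - ξ⌋ - ⌊x - ξ⌋ := by
      have := Finset.sum_range_sub (fun i : ℕ => (⌊x + i * ξ - ξ⌋ : ℝ)) N
      simp only [Nat.cast_zero, zero_mul, add_zero] at this
      rw [← this]
      refine Finset.sum_congr rfl fun i _ => ?_
      rw [show x + (i + 1 : ℕ) * ξ - ξ = x + i * ξ by push_cast; ring]
    rw [this, abs_le]
    have h1 := Int.floor_le (x + N * ξ - ξ)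
    have h2 := Int.lt_floor_add_one (x + N * ξ - ξ)
    have h3 := Int.floor_le (x - ξ)
    have h4 := Int.lt_floor_add_one (x - ξ)
    constructor <;> linarith
  induction k with
  | zero => exact ⟨0, by simp⟩
  | succ k ih =>
    obtain ⟨C, hC⟩ := ih
    refine ⟨C + 1, fun N x => ?_⟩
    have h1 := hC N x
    have h2 := tel N (x - k * ξ)
    rw [abs_le] at *
    have : ∑ i ∈ Finset.range N, ((⌊x + i * ξ⌋ : ℝ) - ⌊x + i * ξ - (k + 1 : ℤ) * ξ⌋) =
        ∑ i ∈ Finset.range N, ((⌊x + i * ξ⌋ : ℝ) - ⌊x + i * ξ - (k : ℤ) * ξ⌋) +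
        ∑ i ∈ Finset.range N, ((⌊x - k * ξ + i * ξ⌋ : ℝ) - ⌊x - k * ξ + i * ξ - ξ⌋) := by
      rw [← Finset.sum_add_distrib]
      refine Finset.sum_congr rfl fun i _ => ?_
      rw [show x - k * ξ + i * ξ = x + i * ξ - (k : ℤ) * ξ by push_cast; ring,
        show x + i * ξ - (k : ℤ) * ξ - ξ = x + i * ξ - (k + 1 : ℤ) * ξ by push_cast; ring]
      ring
    rw [this]
    push_cast at *
    constructor <;> linarith
  | pred k ih =>
    obtain ⟨C, hC⟩ := ih
    refine ⟨C + 1, fun N x => ?_⟩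
    have h1 := hC N x
    have h2 := tel N (x + k * ξ + ξ)
    rw [abs_le] at *
    have : ∑ i ∈ Finset.range N, ((⌊x + i * ξ⌋ : ℝ) - ⌊x + i * ξ - (-k - 1 : ℤ) * ξ⌋) =
        ∑ i ∈ Finset.range N, ((⌊x + i * ξ⌋ : ℝ) - ⌊x + i * ξ - (-k : ℤ) * ξ⌋) -
        ∑ i ∈ Finset.range N, ((⌊x + k * ξ + ξ + i * ξ⌋ : ℝ) - ⌊x + k * ξ + ξ + i * ξ - ξ⌋) := by
      rw [← Finset.sum_sub_distrib]
      refine Finset.sum_congr rfl fun i _ => ?_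
      rw [show x + k * ξ + ξ + i * ξ = x + i * ξ - (-k - 1 : ℤ) * ξ by push_cast; ring,
        show x + i * ξ - (-k - 1 : ℤ) * ξ - ξ = x + i * ξ - (-k : ℤ) * ξ by push_cast; ring]
      ring
    rw [this]
    push_cast at *
    constructor <;> linarith

/-- Uniform equidistribution of the rotation by `ξ` modulo `1`. -/
theorem sum_floor_sub_floor_equidistributed {ξ : ℝ} (hξ : Irrational ξ) (c : ℝ) {ε : ℝ}
    (hε : 0 < ε) : ∃ N₀ : ℕ, ∀ N ≥ N₀, ∀ x : ℝ,
      |∑ i ∈ Finset.range N, ((⌊x + i * ξ⌋ : ℝ) - ⌊x + i * ξ - c⌋) - N * c| ≤ ε * N := by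
  have hd : ∀ s t : ℝ, s < t → ∃ k l : ℤ, s < k * ξ + l ∧ k * ξ + l < t := by
    intro s t hst
    obtain ⟨z, hz, hs, ht⟩ := ((dense_addSubgroupClosure_pair_iff (a := ξ) (b := 1)).2 (by simpa using hξ)).exists_between hst
    obtain ⟨k, l, h⟩ := AddSubgroup.mem_closure_pair.1 hz
    simp only [zsmul_eq_mul, mul_one] at h
    refine ⟨k, l, ?_, ?_⟩ <;> linarith
  have hs : ∀ k l : ℤ, ∃ C : ℝ, ∀ (N : ℕ) (x : ℝ),
      |∑ i ∈ Finset.range N, ((⌊x + i * ξ⌋ : ℝ) - ⌊x + i * ξ - (k * ξ + l)⌋) -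
        N * (k * ξ + l)| ≤ C := by
    intro k l
    obtain ⟨C, hC⟩ := abs_sum_floor_sub_floor_le ξ k
    refine ⟨C, fun N x => ?_⟩
    have h := hC N x
    have : ∑ i ∈ Finset.range N, ((⌊x + i * ξ⌋ : ℝ) - ⌊x + i * ξ - (k * ξ + l)⌋) =
        ∑ i ∈ Finset.range N, ((⌊x + i * ξ⌋ : ℝ) - ⌊x + i * ξ - k * ξ⌋) + N * l := by
      have hconst : (N : ℝ) * l = ∑ _i ∈ Finset.range N, (l : ℝ) := by simp
      rw [hconst, ← Finset.sum_add_distrib]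
      refine Finset.sum_congr rfl fun i _ => ?_
      rw [← sub_sub, Int.floor_sub_intCast]
      push_cast; ring
    rw [this]
    convert h using 2
    ring
  have hmono : ∀ c c' : ℝ, c ≤ c' → ∀ (N : ℕ) (x : ℝ),
      ∑ i ∈ Finset.range N, ((⌊x + i * ξ⌋ : ℝ) - ⌊x + i * ξ - c⌋) ≤
      ∑ i ∈ Finset.range N, ((⌊x + i * ξ⌋ : ℝ) - ⌊x + i * ξ - c'⌋) := by
    intro c c' h N x
    refine Finset.sum_le_sum fun i _ => ?_
    have : ⌊x + i * ξ - c'⌋ ≤ ⌊x + i * ξ - c⌋ := Int.floor_le_floor (by linarith)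
    have : (⌊x + i * ξ - c'⌋ : ℝ) ≤ ⌊x + i * ξ - c⌋ := by exact_mod_cast this
    linarith
  -- The sums are monotone in c, so c is squeezed between two elements of ℤξ + ℤ within ε/2, both of
  -- bounded discrepancy.
  obtain ⟨k₁, l₁, h₁, h₁'⟩ := hd (c - ε / 2) c (by linarith)
  obtain ⟨k₂, l₂, h₂, h₂'⟩ := hd c (c + ε / 2) (by linarith)
  obtain ⟨C₁, hC₁⟩ := hs k₁ l₁
  obtain ⟨C₂, hC₂⟩ := hs k₂ l₂
  obtain ⟨N₀, hN₀⟩ := exists_nat_ge (max C₁ C₂ / (ε / 2))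
  refine ⟨N₀, fun N hN x => ?_⟩
  have hN' : max C₁ C₂ ≤ ε / 2 * N := by
    rw [div_le_iff₀ (by linarith)] at hN₀
    have : (N₀ : ℝ) ≤ N := by exact_mod_cast hN
    nlinarith
  have e₁ := abs_le.1 (hC₁ N x)
  have e₂ := abs_le.1 (hC₂ N x)
  have m₁ := hmono _ _ h₁'.le N x
  have m₂ := hmono _ _ h₂.le N x
  have b₁ := le_max_left C₁ C₂
  have b₂ := le_max_right C₁ C₂
  have n0 : (0 : ℝ) ≤ N := Nat.cast_nonneg N
  have q₁ := mul_le_mul_of_nonneg_left h₁.le n0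
  have q₂ := mul_le_mul_of_nonneg_left h₂'.le n0
  rw [abs_le]
  constructor
  · linarith [e₁.1]
  · linarith [e₂.2]

theorem irrational_half_angle : Irrational (angle / 2) := by
  simpa using irrational_angle.div_natCast (m := 2) (by norm_num)

/-- The orbit of the rotation on `ℝ / 2ℤ` visits every interval. -/
theorem exists_orbit_mem_Ico {α β : ℝ} (h : α < β) :
    ∃ (i : ℕ) (t : ℤ), (i + 1 : ℝ) * angle + 2 * t ∈ Set.Ico α β := by
  have hc : 0 < (β - α) / 4 := by linarith
  obtain ⟨N, hN⟩ := sum_floor_sub_floor_equidistributed irrational_half_angle ((β - α) / 2) hc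
  have h1 := (abs_le.1 (hN (N + 1) (by omega) ((angle - α) / 2))).1
  by_contra! hcon
  -- Halving turns ℝ/2ℤ into ℝ/ℤ. A positive summand would give an integer in the window, that is, a
  -- visit to the interval; without visits the sum contradicts its linear lower bound.
  have h2 : ∑ i ∈ Finset.range (N + 1), ((⌊(angle - α) / 2 + i * (angle / 2)⌋ : ℝ) -
      ⌊(angle - α) / 2 + i * (angle / 2) - (β - α) / 2⌋) ≤ 0 := by
    refine Finset.sum_nonpos fun i _ => ?_
    by_contra! hlt
    have hlt' : ⌊(angle - α) / 2 + i * (angle / 2) - (β - α) / 2⌋ <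
      ⌊(angle - α) / 2 + i * (angle / 2)⌋ := by
      exact_mod_cast sub_pos.1 hlt
    have h3 := Int.floor_lt.1 hlt'
    have h4 := Int.floor_le ((angle - α) / 2 + i * (angle / 2))
    refine hcon i (-⌊(angle - α) / 2 + i * (angle / 2)⌋) ⟨?_, ?_⟩ <;> push_cast <;> linarith
  have : (0 : ℝ) < (N + 1 : ℕ) := by positivity
  nlinarith

/-! ### From visits of the orbit to frequencies -/

theorem prefix_drop_factorAt_iff {A : Type*} (u : ℕ → A) (w : List A) (p N i : ℕ)
    (hi : i < N) :
    w <+: (factorAt u p N).drop i ↔ i + w.length ≤ N ∧ factorAt u (p + i) w.length = w := by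
  obtain ⟨M, rfl⟩ := Nat.exists_eq_add_of_le hi.le
  have hdrop : (factorAt u p (i + M)).drop i = factorAt u (p + i) M := by
    rw [factorAt_add, List.drop_left' (length_factorAt u p i)]
  rw [hdrop]
  constructor
  · intro h
    have hl : w.length ≤ M := by simpa [length_factorAt] using h.length_le
    refine ⟨by omega, ?_⟩
    obtain ⟨M', rfl⟩ := Nat.exists_eq_add_of_le hl
    rw [factorAt_add] at h
    rw [List.prefix_iff_eq_take, List.take_left' (length_factorAt u _ _)] at h
    exact h.symm
  · rintro ⟨h1, h2⟩
    obtain ⟨M', rfl⟩ := Nat.exists_eq_add_of_le (show w.length ≤ M by omega)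
    rw [factorAt_add, h2]
    exact List.prefix_append _ _

theorem occurrences_factorAt_bounds {A : Type*} [DecidableEq A] (u : ℕ → A) (w : List A)
    (p N : ℕ) :
    occurrences w (factorAt u p N) ≤
      ((Finset.range N).filter fun i => factorAt u (p + i) w.length = w).card ∧
    ((Finset.range N).filter fun i => factorAt u (p + i) w.length = w).card ≤
      occurrences w (factorAt u p N) + w.length := by
  have ho : occurrences w (factorAt u p N) = ((Finset.range N).filter fun i =>
      i + w.length ≤ N ∧ factorAt u (p + i) w.length = w).card := by
    unfold occurrences
    rw [length_factorAt]
    congr 1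
    refine Finset.filter_congr fun i hi => ?_
    exact prefix_drop_factorAt_iff u w p N i (Finset.mem_range.1 hi)
  rw [ho]
  constructor
  · refine Finset.card_le_card fun i => ?_
    simp only [Finset.mem_filter]
    tauto
  · calc _ ≤ (((Finset.range N).filter fun i =>
          i + w.length ≤ N ∧ factorAt u (p + i) w.length = w) ∪
          Finset.Ico (N - w.length) N).card := by
          refine Finset.card_le_card fun i => ?_
          simp only [Finset.mem_filter, Finset.mem_union, Finset.mem_range, Finset.mem_Ico]
          intro h
          by_cases hle : i + w.length ≤ N
          · exact Or.inl ⟨h.1, hle, h.2⟩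
          · right; omega
      _ ≤ _ := by
          refine (Finset.card_union_le _ _).trans ?_
          rw [Nat.card_Ico]
          omega

/-- A long factor may start at any position p, so the estimate must be uniform in p. Occurrences
overhanging the end of the factor number at most the length of `w`, negligible after division. -/
theorem hasFrequency_of_uniform {A : Type*} [DecidableEq A] (u : ℕ → A) (w : List A) (x : ℝ)
    (h : ∀ ε > 0, ∃ N₀ : ℕ, ∀ N ≥ N₀, ∀ p : ℕ,
      |(((Finset.range N).filter fun i => factorAt u (p + i) w.length = w).card : ℝ) - N * x|
        ≤ ε * N) : HasFrequency u w x := by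
  unfold HasFrequency
  rw [Metric.tendsto_nhds]
  intro ε hε
  obtain ⟨N₀, hN₀⟩ := h (ε / 3) (by linarith)
  obtain ⟨N₁, hN₁⟩ := exists_nat_ge (w.length / (ε / 3))
  rw [longFactors, eventually_inf_principal]
  filter_upwards [preimage_mem_comap (Ici_mem_atTop (max N₀ (N₁ + 1)))] with v hv hvl
  obtain ⟨N, p, rfl⟩ := hvl
  simp only [Set.mem_preimage, length_factorAt, Set.mem_Ici, max_le_iff] at hv
  rw [length_factorAt]
  have hb := occurrences_factorAt_bounds u w p N
  have hb1 : (occurrences w (factorAt u p N) : ℝ) ≤ _ := Nat.cast_le.2 hb.1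
  have hb2 := (Nat.cast_le (α := ℝ)).2 hb.2
  push_cast at hb2
  have hu := abs_le.1 (hN₀ N hv.1 p)
  have hNpos : (0 : ℝ) < N := by exact_mod_cast (show 0 < N by omega)
  have hw : (w.length : ℝ) ≤ ε / 3 * N := by
    rw [div_le_iff₀ (by linarith)] at hN₁
    have : (N₁ : ℝ) ≤ N := by exact_mod_cast (show N₁ ≤ N by omega)
    nlinarith
  rw [Real.dist_eq, div_sub' hNpos.ne', abs_div, abs_of_pos hNpos, div_lt_iff₀ hNpos, abs_lt]
  have := mul_pos hε hNpos
  constructor <;> linarith [hu.1, hu.2]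

theorem neBot_longFactors {A : Type*} (u : ℕ → A) : (longFactors u).NeBot := by
  rw [longFactors, inf_principal_neBot_iff]
  intro s hs
  obtain ⟨t, ht, hts⟩ := hs
  obtain ⟨N, hN⟩ := mem_atTop_sets.1 ht
  exact ⟨factorAt u 0 N, hts (hN _ (by rw [length_factorAt])), N, 0, rfl⟩

theorem HasFrequency.frequency_eq {A : Type*} [DecidableEq A] {u : ℕ → A} {w : List A} {x : ℝ}
    (h : HasFrequency u w x) : frequency u w = x :=
  have := neBot_longFactors u
  h.limUnder_eq

/-! ### The three-gap theorem -/

/-- `x` and `y` are positive representatives modulo `1` of `a θ` and `-b θ`, the corresponding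
fractions `p / a` and `q / b` are Farey neighbours, and `m < a + b`. -/
structure Neighbours (θ : ℝ) (m a b : ℕ) (x y : ℝ) : Prop where
  x_pos : 0 < x
  y_pos : 0 < y
  lt_add : m < a + b
  unimodular : ∃ p q : ℤ, x = a * θ - p ∧ y = q - b * θ ∧ a * q - b * p = 1

/-- The distance from `-j θ` to the next point on its right among the points `-i θ`, `i ≤ m`,
modulo `1`. -/
noncomputable def gapLength (m a b : ℕ) (x y : ℝ) (j : ℕ) : ℝ :=
  if a ≤ j then x else if j + b ≤ m then y else x + y

variable {θ : ℝ} {m a b : ℕ} {x y : ℝ}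

/-- Unimodularity makes sθ - r = Ax + By and s = aA - bB with integers A, B. Opposite signs of A and
B would force |s| ≥ a + b > m, so a positive value has A, B ≥ 0, not both zero. -/
theorem Neighbours.le_of_pos (G : Neighbours θ m a b x y) {s r : ℤ} (hs : |s| ≤ m)
    (hd : 0 < s * θ - r) :
    (x ≤ s * θ - r ∧ a ≤ s) ∨ (y ≤ s * θ - r ∧ s ≤ -b) ∨ x + y ≤ s * θ - r := by
  obtain ⟨hx, hy, hlt, p, q, ex, ey, det⟩ := G
  obtain ⟨A, hA⟩ : ∃ A : ℤ, A = s * q - r * b := ⟨_, rfl⟩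
  obtain ⟨B, hB⟩ : ∃ B : ℤ, B = s * p - r * a := ⟨_, rfl⟩
  have h1 : s = a * A - b * B := by rw [hA, hB]; linear_combination (-s) * det
  have h2 : r = p * A - q * B := by rw [hA, hB]; linear_combination (-r) * det
  have h3 : s * θ - r = A * x + B * y := by
    rw [h1, h2, ex, ey]; push_cast; ring
  rw [h3] at hd ⊢
  have hs' := abs_le.1 hs
  have hlt' : (m : ℤ) < a + b := by exact_mod_cast hlt
  have ha0 : (0 : ℤ) ≤ a := Int.natCast_nonneg a
  have hb0 : (0 : ℤ) ≤ b := Int.natCast_nonneg b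
  rcases le_or_gt A 0 with hA0 | hA0 <;> rcases le_or_gt B 0 with hB0 | hB0
  · have e1 : (A : ℝ) ≤ 0 := by exact_mod_cast hA0
    have e2 : (B : ℝ) ≤ 0 := by exact_mod_cast hB0
    nlinarith
  · rcases hA0.lt_or_eq with hA1 | rfl
    · have e1 : (a : ℤ) * A ≤ a * (-1) := mul_le_mul_of_nonneg_left (by omega) ha0
      have e2 : (b : ℤ) * 1 ≤ b * B := mul_le_mul_of_nonneg_left (by omega) hb0
      linarith
    · have e1 : (1 : ℝ) ≤ B := by exact_mod_cast hB0
      refine Or.inr (Or.inl ⟨?_, ?_⟩)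
      · push_cast; nlinarith
      · nlinarith
  · rcases hB0.lt_or_eq with hB1 | rfl
    · have e1 : (b : ℤ) * B ≤ b * (-1) := mul_le_mul_of_nonneg_left (by omega) hb0
      have e2 : (a : ℤ) * 1 ≤ a * A := mul_le_mul_of_nonneg_left (by omega) ha0
      linarith
    · have e1 : (1 : ℝ) ≤ A := by exact_mod_cast hA0
      refine Or.inl ⟨?_, ?_⟩
      · push_cast; nlinarith
      · nlinarith
  · have e1 : (1 : ℝ) ≤ A := by exact_mod_cast hA0
    have e2 : (1 : ℝ) ≤ B := by exact_mod_cast hB0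
    refine Or.inr (Or.inr ?_)
    nlinarith

theorem Neighbours.gapLength_pos (G : Neighbours θ m a b x y) (j : ℕ) :
    0 < gapLength m a b x y j := by
  have h1 := G.x_pos
  have h2 := G.y_pos
  unfold gapLength
  split_ifs <;> linarith

theorem Neighbours.gapLength_le_add (G : Neighbours θ m a b x y) (j : ℕ) :
    gapLength m a b x y j ≤ x + y := by
  have h1 := G.x_pos
  have h2 := G.y_pos
  unfold gapLength
  split_ifs <;> linarith

theorem Neighbours.gapLength_le (G : Neighbours θ m a b x y) {i j : ℕ} (hi : i ≤ m) (hj : j ≤ m)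
    {r g : ℤ} (hlt : (g - j * θ : ℝ) < r - i * θ) :
    g - j * θ + gapLength m a b x y j ≤ r - i * θ := by
  have hs : |(j - i : ℤ)| ≤ m := by rw [abs_le]; constructor <;> omega
  have hl := G.lt_add
  have h := G.le_of_pos (s := j - i) (r := g - r) hs (by push_cast; linarith)
  have hle := G.gapLength_le_add j
  push_cast at h
  rcases h with ⟨h, h'⟩ | ⟨h, h'⟩ | h
  · have : gapLength m a b x y j = x := if_pos (by omega)
    linarith
  · have : gapLength m a b x y j = y := by
      rw [gapLength, if_neg (by omega), if_pos (by omega)]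
    linarith
  · linarith

theorem Neighbours.floor_eq (G : Neighbours θ m a b x y) {i j : ℕ} (hi : i ≤ m) (hj : j ≤ m)
    {g : ℤ} {z : ℝ} (h1 : g - j * θ ≤ z) (h2 : z < g - j * θ + gapLength m a b x y j) :
    ⌊z + i * θ⌋ = ⌊(g - j * θ : ℝ) + i * θ⌋ := by
  refine le_antisymm ?_ (Int.floor_le_floor (by linarith))
  by_contra! h
  have h3 := Int.floor_lt.1 h
  have h4 := G.gapLength_le hi hj (r := ⌊z + i * θ⌋) (g := g) (by linarith)
  linarith [Int.floor_le (z + i * θ)]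

theorem Neighbours.exists_right_end (G : Neighbours θ m a b x y) (ha : a ≤ m) (hb : b ≤ m)
    {j : ℕ} (hj : j ≤ m) (g : ℤ) :
    ∃ i ≤ m, ∃ r : ℤ, (g - j * θ + gapLength m a b x y j : ℝ) = r - i * θ := by
  obtain ⟨hx, hy, hlt, p, q, ex, ey, det⟩ := G
  unfold gapLength
  split_ifs with h1 h2
  · refine ⟨j - a, by omega, g - p, ?_⟩
    rw [Nat.cast_sub h1, ex]; push_cast; ring
  · refine ⟨j + b, h2, g + q, ?_⟩
    rw [ey]; push_cast; ring
  · refine ⟨j + b - a, by omega, g + q - p, ?_⟩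
    rw [Nat.cast_sub (by omega), ex, ey]; push_cast; ring

theorem Neighbours.floor_eq_iff (G : Neighbours θ m a b x y) (ha : a ≤ m) (hb : b ≤ m)
    {j : ℕ} (hj : j ≤ m) (g : ℤ) (z : ℝ) :
    (∀ i : ℕ, i ≤ m → ⌊z + i * θ⌋ = ⌊(g - j * θ : ℝ) + i * θ⌋) ↔
      g - j * θ ≤ z ∧ z < g - j * θ + gapLength m a b x y j := by
  constructor
  · intro h
    constructor
    · have h1 := h j hj
      rw [sub_add_cancel, Int.floor_intCast] at h1
      have := Int.floor_le (z + j * θ)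
      rw [h1] at this
      linarith
    · obtain ⟨i, hi, r, hr⟩ := G.exists_right_end ha hb hj g
      have h1 := h i hi
      have h2 := G.gapLength_pos j
      have h3 : ⌊z + i * θ⌋ < r := by rw [h1, Int.floor_lt]; linarith
      rw [Int.floor_lt] at h3
      linarith
  · rintro ⟨h1, h2⟩ i hi
    exact G.floor_eq hi hj h1 h2

/-- The nearest division point to the left of z is found by minimising the fractional part of z +
jθ. -/
theorem exists_left_end (θ : ℝ) (m : ℕ) (z : ℝ) :
    ∃ j ≤ m, ∃ g : ℤ, ∀ i : ℕ, i ≤ m → ⌊z + i * θ⌋ = ⌊(g - j * θ : ℝ) + i * θ⌋ := by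
  obtain ⟨j, hj, hmin⟩ := Finset.exists_min_image (Finset.range (m + 1))
    (fun j : ℕ => Int.fract (z + j * θ)) ⟨0, by simp⟩
  have hj' : j ≤ m := by simpa [Nat.lt_succ_iff] using hj
  refine ⟨j, hj', ⌊z + j * θ⌋, fun i hi => ?_⟩
  have h := hmin i (by simpa [Nat.lt_succ_iff] using hi)
  unfold Int.fract at h
  have h2 := Int.floor_le (z + j * θ)
  refine le_antisymm ?_ (Int.floor_le_floor (by linarith))
  rw [Int.le_floor]
  linarith

/-! ### Frequencies as half gap lengths -/

/-- The determinant relation reads ay + bx = 1 with a, b ≥ 1. The bound lets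
`floor_sub_floor_eq_ite` be applied to half a gap. -/
theorem Neighbours.add_le_one (G : Neighbours θ m a b x y) (ha : a ≤ m) (hb : b ≤ m) :
    x + y ≤ 1 := by
  obtain ⟨hx, hy, hlt, p, q, ex, ey, det⟩ := G
  have ha1 : (1 : ℝ) ≤ a := by exact_mod_cast (show 1 ≤ a by omega)
  have hb1 : (1 : ℝ) ≤ b := by exact_mod_cast (show 1 ≤ b by omega)
  have det' : (a * q - b * p : ℝ) = 1 := by exact_mod_cast det
  have : a * y + b * x = 1 := by rw [ex, ey]; linear_combination det'
  nlinarith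

theorem floor_sub_floor_eq_ite {c : ℝ} (hc0 : 0 ≤ c) (hc1 : c ≤ 1) (z : ℝ)
    [Decidable (∃ t : ℤ, 0 ≤ z + t ∧ z + t < c)] :
    (⌊z⌋ : ℝ) - ⌊z - c⌋ = if ∃ t : ℤ, 0 ≤ z + t ∧ z + t < c then 1 else 0 := by
  have h1 := Int.floor_le z
  have h2 := Int.lt_floor_add_one z
  split_ifs with h
  · obtain ⟨t, ht1, ht2⟩ := h
    have e1 : ⌊z⌋ = -t := by
      rw [Int.floor_eq_iff]; push_cast; constructor <;> linarith
    have e2 : ⌊z - c⌋ = -t - 1 := by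
      rw [Int.floor_eq_iff]; push_cast; constructor <;> linarith
    rw [e1, e2]; push_cast; ring
  · have : c ≤ z - ⌊z⌋ := by
      by_contra! hlt
      exact h ⟨-⌊z⌋, by push_cast; linarith, by push_cast; linarith⟩
    have e2 : ⌊z - c⌋ = ⌊z⌋ := by
      rw [Int.floor_eq_iff]; constructor <;> linarith
    rw [e2, sub_self]

/-- Occurrences of the factor are the visits of the orbit to its cell modulo 2; after halving, these
are visits modulo 1 to an interval of half the gap length. -/
theorem Neighbours.hasFrequency_factorAt (G : Neighbours angle m a b x y) (ha : a ≤ m)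
    (hb : b ≤ m) {j : ℕ} (hj : j ≤ m) (g : ℤ) (i : ℕ)
    (h1 : g - j * angle ≤ (i + 1) * angle)
    (h2 : (i + 1) * angle < g - j * angle + gapLength m a b x y j) :
    HasFrequency rotationWord (factorAt rotationWord i m) (gapLength m a b x y j / 2) := by
  classical
  have hm : 1 ≤ m := by have := G.lt_add; omega
  set α : ℝ := g - j * angle with hα
  set l := gapLength m a b x y j with hl
  have hl0 : 0 < l := G.gapLength_pos j
  have hl1 : l ≤ 1 := (G.gapLength_le_add j).trans (G.add_le_one ha hb)
  have hcell := (G.floor_eq_iff ha hb hj g ((i + 1) * angle)).2 ⟨h1, h2⟩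
  have heq : ∀ k : ℕ, factorAt rotationWord k m = factorAt rotationWord i m ↔
      ∃ t : ℤ, 0 ≤ ((k + 1) * angle - α) / 2 + t ∧ ((k + 1) * angle - α) / 2 + t < l / 2 := by
    intro k
    rw [eq_comm, factorAt_rotationWord_eq_iff i k m hm]
    refine exists_congr fun t => ?_
    have h := G.floor_eq_iff ha hb hj g ((k + 1) * angle + 2 * t)
    rw [show (0 ≤ ((k + 1) * angle - α) / 2 + t ∧ ((k + 1) * angle - α) / 2 + t < l / 2) ↔
      (α ≤ (k + 1) * angle + 2 * t ∧ (k + 1) * angle + 2 * t < α + l) by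
        constructor <;> rintro ⟨u1, u2⟩ <;> constructor <;> linarith, ← h]
    refine forall₂_congr fun i' hi' => ?_
    rw [hcell i' hi', eq_comm]
  refine hasFrequency_of_uniform _ _ _ fun ε hε => ?_
  obtain ⟨N₀, hN₀⟩ := sum_floor_sub_floor_equidistributed irrational_half_angle (l / 2) hε
  refine ⟨N₀, fun N hN p => ?_⟩
  convert hN₀ N hN (((p + 1) * angle - α) / 2) using 3
  rw [Finset.card_filter, Nat.cast_sum]
  refine Finset.sum_congr rfl fun k _ => ?_
  rw [floor_sub_floor_eq_ite (by linarith) (by linarith), length_factorAt]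
  push_cast
  refine if_congr ?_ rfl rfl
  rw [heq]
  refine exists_congr fun t => ?_
  push_cast
  rw [show ((p + k + 1) * angle - α) / 2 = ((p + 1) * angle - α) / 2 + k * (angle / 2) by ring]

theorem Neighbours.exists_hasFrequency (G : Neighbours angle m a b x y) (ha : a ≤ m)
    (hb : b ≤ m) (i : ℕ) : ∃ j ≤ m,
    HasFrequency rotationWord (factorAt rotationWord i m) (gapLength m a b x y j / 2) := by
  obtain ⟨j, hj, g, h⟩ := exists_left_end angle m ((i + 1) * angle)
  obtain ⟨h1, h2⟩ := (G.floor_eq_iff ha hb hj g _).1 h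
  exact ⟨j, hj, G.hasFrequency_factorAt ha hb hj g i h1 h2⟩

theorem Neighbours.frequencySet_eq (G : Neighbours angle m a b x y) (ha : a ≤ m)
    (hb : b ≤ m) : frequencySet rotationWord m =
      (fun j => gapLength m a b x y j / 2) '' Set.Iic m := by
  apply Set.Subset.antisymm
  · rintro _ ⟨_, ⟨i, rfl⟩, rfl⟩
    obtain ⟨j, hj, h⟩ := G.exists_hasFrequency ha hb i
    exact ⟨j, hj, h.frequency_eq.symm⟩
  · rintro _ ⟨j, hj, rfl⟩
    have hpos := G.gapLength_pos j
    obtain ⟨i, t, h1, h2⟩ := exists_orbit_mem_Ico (α := -(j * angle))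
      (β := -(j * angle) + gapLength m a b x y j) (by linarith)
    refine ⟨_, ⟨i, rfl⟩, (G.hasFrequency_factorAt ha hb hj (-2 * t) i ?_ ?_).frequency_eq⟩ <;>
      push_cast <;> linarith

theorem Neighbours.frequencySet_eq_pair (G : Neighbours angle m a b x y) (ha : a ≤ m)
    (hb : b ≤ m) (h : m + 1 = a + b) : frequencySet rotationWord m = {x / 2, y / 2} := by
  rw [G.frequencySet_eq ha hb]
  ext f
  simp only [Set.mem_image, Set.mem_Iic, Set.mem_insert_iff, Set.mem_singleton_iff]
  constructor
  · rintro ⟨j, hj, rfl⟩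
    unfold gapLength
    split_ifs with h1 h2
    · exact Or.inl rfl
    · exact Or.inr rfl
    · omega
  · rintro (rfl | rfl)
    · exact ⟨m, le_rfl, by rw [gapLength, if_pos ha]⟩
    · exact ⟨0, by omega, by rw [gapLength, if_neg (by omega), if_pos (by omega)]⟩

theorem Neighbours.frequencySet_eq_triple (G : Neighbours angle m a b x y) (ha : a ≤ m)
    (hb : b ≤ m) (h : m + 1 < a + b) :
    frequencySet rotationWord m = {x / 2, y / 2, (x + y) / 2} := by
  rw [G.frequencySet_eq ha hb]
  ext f
  simp only [Set.mem_image, Set.mem_Iic, Set.mem_insert_iff, Set.mem_singleton_iff]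
  constructor
  · rintro ⟨j, hj, rfl⟩
    unfold gapLength
    split_ifs with h1 h2
    · exact Or.inl rfl
    · exact Or.inr (Or.inl rfl)
    · exact Or.inr (Or.inr rfl)
  · rintro (rfl | rfl | rfl)
    · exact ⟨m, le_rfl, by rw [gapLength, if_pos ha]⟩
    · exact ⟨0, by omega, by rw [gapLength, if_neg (by omega), if_pos (by omega)]⟩
    -- The index a - 1 misses the first case by one, and a - 1 + b > m misses the second: this is a
    -- long gap.
    · exact ⟨a - 1, by omega, by rw [gapLength, if_neg (by omega), if_neg (by omega)]⟩

/-! ### Bispecial factors -/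

theorem floor_add_even (z w : ℝ) (s : ℤ) : ⌊z + 2 * s + w⌋ = ⌊z + w⌋ + 2 * s := by
  rw [← Int.floor_add_intCast]
  push_cast
  congr 1; ring

theorem factorAt_eq_of_floor_eq {i k n : ℕ} (hn : 1 ≤ n) {s t : ℤ}
    (h : ∀ j : ℕ, j ≤ n → ⌊(i + 1 : ℝ) * angle + 2 * s + j * angle⌋ =
      ⌊(k + 1 : ℝ) * angle + 2 * t + j * angle⌋) :
    factorAt rotationWord i n = factorAt rotationWord k n := by
  refine (factorAt_rotationWord_eq_iff i k n hn).2 ⟨t - s, fun j hj => ?_⟩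
  have := h j hj
  rw [floor_add_even, floor_add_even] at *
  linarith

/-- Equal factors have integer parts differing by a constant, so agreement at one index `j₀` forces
agreement at all. -/
theorem floor_eq_of_factorAt_eq {i k n : ℕ} (hn : 1 ≤ n) {s t : ℤ} {j₀ : ℕ} (hj₀ : j₀ ≤ n)
    (h : factorAt rotationWord i n = factorAt rotationWord k n)
    (h₀ : ⌊(i + 1 : ℝ) * angle + 2 * s + j₀ * angle⌋ =
      ⌊(k + 1 : ℝ) * angle + 2 * t + j₀ * angle⌋) {j : ℕ} (hj : j ≤ n) :
    ⌊(i + 1 : ℝ) * angle + 2 * s + j * angle⌋ =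
      ⌊(k + 1 : ℝ) * angle + 2 * t + j * angle⌋ := by
  obtain ⟨c, hc⟩ := (factorAt_rotationWord_eq_iff i k n hn).1 h
  have h1 := hc j₀ hj₀
  have h2 := hc j hj
  rw [floor_add_even] at *
  rw [floor_add_even] at *
  linarith

theorem Neighbours.mono {θ : ℝ} {m m' a b : ℕ} {x y : ℝ} (G : Neighbours θ m a b x y)
    (h : m' < a + b) : Neighbours θ m' a b x y :=
  ⟨G.x_pos, G.y_pos, h, G.unimodular⟩

/-- At level n one gap of length x + y remains modulo 1. Its cell is cut by a point of level n + 1,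
giving two right extensions, and its translate by -ξ is cut by an integer, giving two left
extensions. -/
theorem Neighbours.exists_isBispecial {n a b : ℕ} {x y : ℝ} (hn : 1 ≤ n)
    (G : Neighbours angle (n + 1) a b x y) (ha : a ≤ n + 1) (hb : b ≤ n + 1)
    (h : n + 2 = a + b) :
    ∃ w ∈ factorsOfLength rotationWord n, IsBispecial rotationWord w := by
  have G' : Neighbours angle n a b x y := G.mono (by omega)
  obtain ⟨hx, hy, -, p, q, ex, ey, -⟩ := id G
  set α : ℝ := (0 : ℤ) - (a - 1 : ℕ) * angle with hα
  have hα' : α = angle - a * angle := by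
    rw [hα, Nat.cast_sub (by omega)]; push_cast; ring
  have hgap : gapLength n a b x y (a - 1) = x + y := by
    rw [gapLength, if_neg (by omega), if_neg (by omega)]
  have hfl : ∀ z z' : ℝ, z ∈ Set.Ico α (α + (x + y)) → z' ∈ Set.Ico α (α + (x + y)) →
      ∀ j : ℕ, j ≤ n → ⌊z + j * angle⌋ = ⌊z' + j * angle⌋ := by
    intro z z' hz hz' j hj
    rw [← hgap] at hz hz'
    rw [G'.floor_eq hj (show a - 1 ≤ n by omega) hz.1 hz.2,
      G'.floor_eq hj (show a - 1 ≤ n by omega) hz'.1 hz'.2]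
  -- The cut on the right is at α + y = q - (n + 1)ξ, and the one on the left at α + x - ξ = -p;
  -- sampling the orbit on both sides of each cut yields the extensions.
  have hab : (n : ℝ) + 2 = a + b := by exact_mod_cast h
  have e1 : α + y = q - (n + 1 : ℕ) * angle := by
    rw [hα', ey]; push_cast; linear_combination angle * hab
  have e2 : α + x = angle - p := by rw [hα', ex]; ring
  obtain ⟨i₁, s₁, l₁, r₁⟩ := exists_orbit_mem_Ico (show α < α + y by linarith)
  obtain ⟨i₂, s₂, l₂, r₂⟩ := exists_orbit_mem_Ico (show α + y < α + (x + y) by linarith)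
  obtain ⟨i₃, s₃, l₃, r₃⟩ := exists_orbit_mem_Ico (show α - angle < α + x - angle by linarith)
  obtain ⟨i₄, s₄, l₄, r₄⟩ :=
    exists_orbit_mem_Ico (show α + x - angle < α + (x + y) - angle by linarith)
  have w₂ : factorAt rotationWord i₁ n = factorAt rotationWord i₂ n :=
    factorAt_eq_of_floor_eq hn (hfl _ _ ⟨l₁, by linarith⟩ ⟨by linarith, r₂⟩)
  have w₃ : factorAt rotationWord i₁ n = factorAt rotationWord (i₃ + 1) n := by
    refine factorAt_eq_of_floor_eq (s := s₁) (t := s₃) hn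
      (hfl _ _ ⟨l₁, by linarith⟩ ⟨?_, ?_⟩) <;> push_cast <;> linarith
  have w₄ : factorAt rotationWord i₁ n = factorAt rotationWord (i₄ + 1) n := by
    refine factorAt_eq_of_floor_eq (s := s₁) (t := s₄) hn
      (hfl _ _ ⟨l₁, by linarith⟩ ⟨?_, ?_⟩) <;> push_cast <;> linarith
  refine ⟨factorAt rotationWord i₁ n, ⟨i₁, rfl⟩, ⟨⟨n, i₁, rfl⟩, ?_⟩, ⟨n, i₁, rfl⟩, ?_⟩
  · rw [← one_add_one_eq_two, ENat.add_one_le_iff (by simp), Set.one_lt_encard_iff]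
    refine ⟨rotationWord i₃, rotationWord i₄, ⟨n + 1, i₃, ?_⟩, ⟨n + 1, i₄, ?_⟩, fun hc => ?_⟩
    · rw [factorAt_succ', w₃]
    · rw [factorAt_succ', w₄]
    · have hf : factorAt rotationWord i₃ (n + 1) = factorAt rotationWord i₄ (n + 1) := by
        rw [factorAt_succ', factorAt_succ', hc, ← w₃, ← w₄]
      have h0 := hfl ((i₃ + 1) * angle + 2 * s₃ + angle) ((i₄ + 1) * angle + 2 * s₄ + angle)
        ⟨by linarith, by linarith⟩ ⟨by linarith, by linarith⟩ 0 (Nat.zero_le _)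
      have h1 := floor_eq_of_factorAt_eq (s := s₃) (t := s₄) (j₀ := 1) (by omega) (by omega) hf
        (by simpa using h0) (j := 0) (by omega)
      have h2 : ⌊(i₃ + 1 : ℝ) * angle + 2 * s₃ + (0 : ℕ) * angle⌋ < -p := by
        rw [Int.floor_lt]; push_cast; linarith
      have h3 : -p ≤ ⌊(i₄ + 1 : ℝ) * angle + 2 * s₄ + (0 : ℕ) * angle⌋ := by
        rw [Int.le_floor]; push_cast; linarith
      omega
  · rw [← one_add_one_eq_two, ENat.add_one_le_iff (by simp), Set.one_lt_encard_iff]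
    refine ⟨rotationWord (i₁ + n), rotationWord (i₂ + n), ⟨n + 1, i₁, ?_⟩, ⟨n + 1, i₂, ?_⟩,
      fun hc => ?_⟩
    · rw [factorAt_succ]
    · rw [factorAt_succ, w₂]
    · have hf : factorAt rotationWord i₁ (n + 1) = factorAt rotationWord i₂ (n + 1) := by
        rw [factorAt_succ, factorAt_succ, hc, w₂]
      have h0 := hfl _ _ ⟨l₁, by linarith⟩ ⟨by linarith, r₂⟩ 0 (Nat.zero_le _)
      have h1 := floor_eq_of_factorAt_eq (by omega) (Nat.zero_le _) hf h0 (le_refl (n + 1))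
      have h2 : ⌊(i₁ + 1 : ℝ) * angle + 2 * s₁ + (n + 1 : ℕ) * angle⌋ < q := by
        rw [Int.floor_lt]; linarith
      have h3 : q ≤ ⌊(i₂ + 1 : ℝ) * angle + 2 * s₂ + (n + 1 : ℕ) * angle⌋ := by
        rw [Int.le_floor]; linarith
      omega

theorem exists_between_of_floor_ne {P : ℝ → Prop} {z z' s : ℝ} (hz : P z) (hz' : P z')
    (h : ⌊z + s⌋ ≠ ⌊z' + s⌋) :
    ∃ (r : ℤ) (l u : ℝ), P l ∧ P u ∧ l < r - s ∧ r - s ≤ u := by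
  rcases lt_or_gt_of_ne h with h | h
  · refine ⟨⌊z' + s⌋, z, z', hz, hz', ?_, ?_⟩
    · linarith [Int.floor_lt.1 h]
    · linarith [Int.floor_le (z' + s)]
  · refine ⟨⌊z + s⌋, z', z, hz', hz, ?_, ?_⟩
    · linarith [Int.floor_lt.1 h]
    · linarith [Int.floor_le (z + s)]

/-- A bispecial cell is cut both by some r - (n + 1)ξ and by some r' + ξ. These cuts differ by (n +
2)ξ - (r - r'), which must lie strictly between -y and x; if n + 2 < a + b, `Neighbours.le_of_pos`
at level n + 2 excludes every such nonzero value, and irrationality excludes 0. -/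
theorem Neighbours.eq_add_of_isBispecial {n a b : ℕ} {x y : ℝ} (hn : 1 ≤ n)
    (G : Neighbours angle (n + 1) a b x y) (ha : a ≤ n + 1) (hb : b ≤ n + 1)
    {w : List (Fin 4)} (hw : w ∈ factorsOfLength rotationWord n)
    (hbi : IsBispecial rotationWord w) : n + 2 = a + b := by
  by_contra hne
  have hlt := G.lt_add
  have G' : Neighbours angle (n + 2) a b x y := G.mono (by omega)
  obtain ⟨hx, hy, -, p, q, ex, ey, -⟩ := id G
  obtain ⟨i₀, rfl⟩ := hw
  obtain ⟨⟨-, hL⟩, -, hR⟩ := hbi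
  rw [← one_add_one_eq_two, ENat.add_one_le_iff (by simp), Set.one_lt_encard_iff] at hL hR
  obtain ⟨c₁, c₂, ⟨N₁, i₁, h₁⟩, ⟨N₂, i₂, h₂⟩, hc⟩ := hR
  obtain ⟨d₁, d₂, ⟨N₃, i₃, h₃⟩, ⟨N₄, i₄, h₄⟩, hd⟩ := hL
  have hlen : ∀ {N i : ℕ} {v : List (Fin 4)}, v = factorAt rotationWord i N → v.length = N :=
    fun h => by rw [h, length_factorAt]
  obtain rfl : n + 1 = N₁ := by simpa [length_factorAt] using hlen h₁
  obtain rfl : n + 1 = N₂ := by simpa [length_factorAt] using hlen h₂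
  obtain rfl : n + 1 = N₃ := by simpa [length_factorAt] using hlen h₃
  obtain rfl : n + 1 = N₄ := by simpa [length_factorAt] using hlen h₄
  have f₁₂ : factorAt rotationWord i₁ (n + 1) ≠ factorAt rotationWord i₂ (n + 1) := by
    rw [← h₁, ← h₂]; simpa using hc
  have f₃₄ : factorAt rotationWord i₃ (n + 1) ≠ factorAt rotationWord i₄ (n + 1) := by
    rw [← h₃, ← h₄]; simpa using hd
  rw [factorAt_succ] at h₁ h₂
  rw [factorAt_succ'] at h₃ h₄
  have g₁ := (List.append_inj' h₁ rfl).1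
  have g₂ := (List.append_inj' h₂ rfl).1
  have g₃ := (List.cons.inj h₃).2
  have g₄ := (List.cons.inj h₄).2
  let P : ℝ → Prop := fun z => ∀ j : ℕ, j ≤ n →
    ⌊(i₀ + 1 : ℝ) * angle + j * angle⌋ = ⌊z + j * angle⌋
  obtain ⟨t₁, p₁⟩ := (factorAt_rotationWord_eq_iff _ _ n hn).1 g₁
  obtain ⟨t₂, p₂⟩ := (factorAt_rotationWord_eq_iff _ _ n hn).1 g₂
  obtain ⟨t₃, p₃⟩ := (factorAt_rotationWord_eq_iff _ _ n hn).1 g₃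
  obtain ⟨t₄, p₄⟩ := (factorAt_rotationWord_eq_iff _ _ n hn).1 g₄
  have n₁₂ : ⌊(i₁ + 1 : ℝ) * angle + 2 * t₁ + (n + 1 : ℕ) * angle⌋ ≠
      ⌊(i₂ + 1 : ℝ) * angle + 2 * t₂ + (n + 1 : ℕ) * angle⌋ := by
    intro h
    refine f₁₂ (factorAt_eq_of_floor_eq (s := t₁) (t := t₂) (by omega) fun j hj => ?_)
    rcases Nat.le_succ_iff.1 hj with hj | rfl
    · rw [← p₁ j hj, ← p₂ j hj]
    · exact h
  -- The preceding letter is governed by the integer part one step back, hence the shift by -ξ.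
  have n₃₄ : ⌊((i₃ + 1 : ℕ) + 1 : ℝ) * angle + 2 * t₃ + -angle⌋ ≠
      ⌊((i₄ + 1 : ℕ) + 1 : ℝ) * angle + 2 * t₄ + -angle⌋ := by
    intro h
    refine f₃₄ (factorAt_eq_of_floor_eq (s := t₃) (t := t₄) (by omega) fun j hj => ?_)
    rcases j with _ | j
    · convert h using 2 <;> push_cast <;> ring
    · have := (p₃ j (by omega)).symm.trans (p₄ j (by omega))
      convert this using 2 <;> push_cast <;> ring
  obtain ⟨r, l, u, hl, hu, hlr, hru⟩ := exists_between_of_floor_ne (P := P) p₁ p₂ n₁₂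
  obtain ⟨r', l', u', hl', hu', hlr', hru'⟩ := exists_between_of_floor_ne (P := P) p₃ p₄ n₃₄
  have hcross : ∀ (v v' : ℝ) (j : ℕ) (c : ℤ), j ≤ n → P v → P v' → v < c - j * angle →
      v' < c - j * angle := by
    intro v v' j c hj hv hv' hlt
    have h1 : ⌊v + j * angle⌋ < c := by rw [Int.floor_lt]; linarith
    rw [← hv j hj, hv' j hj, Int.floor_lt] at h1
    linarith
  -- Otherwise the point at distance x to the right of the first cut, which is a division point of
  -- level n + 1 - a ≤ n, would separate two points of the same cell. The bound by -y is symmetric.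
  have hdx : ((n + 2 : ℤ) : ℝ) * angle - ((r - r' : ℤ) : ℝ) < x := by
    by_contra! hge
    have e : ((r - p : ℤ) : ℝ) - (n + 1 - a : ℕ) * angle = r - (n + 1 : ℕ) * angle + x := by
      rw [Nat.cast_sub ha, ex]; push_cast; ring
    have := hcross l u' (n + 1 - a) (r - p) (by omega) hl hu' (by rw [e]; linarith)
    push_cast at *
    linarith
  have hdy : -y < ((n + 2 : ℤ) : ℝ) * angle - ((r - r' : ℤ) : ℝ) := by
    by_contra! hge
    have e : ((r - q : ℤ) : ℝ) - (n + 1 - b : ℕ) * angle = r - (n + 1 : ℕ) * angle - y := by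
      rw [Nat.cast_sub hb, ey]; push_cast; ring
    have := hcross l' u (n + 1 - b) (r - q) (by omega) hl' hu (by
      rw [e]; push_cast at *; linarith)
    push_cast at *
    linarith
  rcases lt_trichotomy (((n + 2 : ℤ) : ℝ) * angle - ((r - r' : ℤ) : ℝ)) 0 with h0 | h0 | h0
  · have h1 := G'.le_of_pos (s := -(n + 2)) (r := -(r - r'))
      (by rw [abs_neg, abs_of_nonneg (by omega)]; push_cast; rfl)
      (by push_cast at *; linarith)
    push_cast at *
    rcases h1 with ⟨h, h'⟩ | ⟨h, h'⟩ | h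
    · omega
    · linarith
    · linarith
  · have h1 := (irrational_angle.intCast_mul (m := (n + 2 : ℤ)) (by omega)).ne_int (r - r')
    exact h1 (by linarith)
  · have h1 := G'.le_of_pos (s := n + 2) (r := r - r')
      (by rw [abs_of_nonneg (by omega)]; push_cast; rfl) h0
    rcases h1 with ⟨h, h'⟩ | ⟨h, h'⟩ | h
    · linarith
    · omega
    · linarith

/-! ### The Euclidean algorithm on the gap lengths -/

/-- The pair changes only when n reaches a + b - 1, where the Farey mediant replaces one neighbour
and the smaller gap is subtracted from the larger. Up to a power of 2 - √3 the states cycle through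
(√3, 1), (√3 - 1, 1), (√3 - 1, 2 - √3), and then (√3, 1) with k raised by one. -/
theorem exists_neighbours (n : ℕ) (hn : 1 ≤ n) : ∃ (a b k : ℕ) (x y : ℝ),
    Neighbours angle (n + 1) a b x y ∧ a ≤ n + 1 ∧ b ≤ n + 1 ∧
    ((x = √3 * (2 - √3) ^ (k + 1) ∧ y = (2 - √3) ^ (k + 1)) ∨
     (x = (√3 - 1) * (2 - √3) ^ (k + 1) ∧ y = (2 - √3) ^ (k + 1)) ∨
     (x = (√3 - 1) * (2 - √3) ^ (k + 1) ∧ y = (2 - √3) ^ (k + 2))) := by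
  have hsq : √3 ^ 2 = (3 : ℝ) := Real.sq_sqrt (by norm_num)
  have h1 := angle_gt
  have h2 := angle_lt
  have hang : √3 = angle + 1 := by unfold angle; ring
  have hpow : ∀ k : ℕ, 0 < (2 - √3) ^ k := fun k => pow_pos (by linarith) k
  induction n, hn using Nat.le_induction with
  | base =>
    -- The initial Farey neighbours are 1/2 < ξ < 1/1.
    refine ⟨2, 1, 0, 2 * angle - 1, 1 - angle, ⟨by linarith, by linarith, by norm_num,
      1, 1, by norm_num, by norm_num, by norm_num⟩, by norm_num, by norm_num, Or.inl ⟨?_, ?_⟩⟩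
    · unfold angle; linear_combination hsq
    · unfold angle; ring
  | succ n hn ih =>
    obtain ⟨a, b, k, x, y, G, ha, hb, hst⟩ := ih
    by_cases hlt : n + 1 + 1 < a + b
    · exact ⟨a, b, k, x, y, G.mono hlt, by omega, by omega, hst⟩
    · have hlt' := G.lt_add
      obtain ⟨hx, hy, -, p, q, ex, ey, det⟩ := G
      have hleft : y < x → Neighbours angle (n + 1 + 1) (a + b) b (x - y) y := fun h =>
        ⟨by linarith, hy, by omega, p + q, q, by rw [ex, ey]; push_cast; ring, ey,
          by push_cast; linear_combination det⟩
      have hright : x < y → Neighbours angle (n + 1 + 1) a (a + b) x (y - x) := fun h =>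
        ⟨hx, by linarith, by omega, p, p + q, ex, by rw [ex, ey]; push_cast; ring,
          by push_cast; linear_combination det⟩
      have hk := hpow (k + 1)
      rcases hst with ⟨rfl, rfl⟩ | ⟨rfl, rfl⟩ | ⟨rfl, rfl⟩
      · refine ⟨a + b, b, k, _, _, hleft (by nlinarith), by omega, by omega,
          Or.inr (Or.inl ⟨by ring, rfl⟩)⟩
      · refine ⟨a, a + b, k, _, _, hright (by nlinarith), by omega, by omega,
          Or.inr (Or.inr ⟨rfl, by ring⟩)⟩
      · refine ⟨a + b, b, k + 1, _, _, hleft (by rw [pow_succ _ (k + 1)]; nlinarith), by omega,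
          by omega, Or.inl ⟨?_, rfl⟩⟩
        linear_combination (2 - √3) ^ (k + 1) * hsq

end FactorFrequency

theorem mainTheorem5 (n : ℕ) (hn : 1 ≤ n) :
    (∀ e ∈ factorsOfLength exampleWord (n + 1),
      HasFrequency exampleWord e (frequency exampleWord e)) ∧
    ((∃ w ∈ factorsOfLength exampleWord n, IsBispecial exampleWord w) →
      (∃ k : ℕ,
        frequencySet exampleWord (n + 1) =
            {1 / (2 * lam ^ (k + 1)), √3 / (2 * lam ^ (k + 1))} ∨
        frequencySet exampleWord (n + 1) =
            {1 / (2 * lam ^ (k + 1)), (√3 - 1) / (2 * lam ^ (k + 1))} ∨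
        frequencySet exampleWord (n + 1) =
            {(√3 - 1) / (2 * lam ^ (k + 1)), 1 / (2 * lam ^ (k + 2))}) ∧
      (frequencySet exampleWord (n + 1)).ncard = 2) ∧
    ((¬ ∃ w ∈ factorsOfLength exampleWord n, IsBispecial exampleWord w) →
      (∃ k : ℕ,
        frequencySet exampleWord (n + 1) =
            {(√3 - 1) / (2 * lam ^ k), 1 / (2 * lam ^ (k + 1)), √3 / (2 * lam ^ (k + 1))} ∨
        frequencySet exampleWord (n + 1) =
            {√3 / (2 * lam ^ (k + 1)), 1 / (2 * lam ^ (k + 1)),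
              (√3 - 1) / (2 * lam ^ (k + 1))} ∨
        frequencySet exampleWord (n + 1) =
            {1 / (2 * lam ^ (k + 1)), (√3 - 1) / (2 * lam ^ (k + 1)),
              1 / (2 * lam ^ (k + 2))}) ∧
      (frequencySet exampleWord (n + 1)).ncard = 3) := by
  rw [exampleWord_eq_rotationWord]
  obtain ⟨a, b, k, x, y, G, ha, hb, hst⟩ := exists_neighbours n hn
  have hx := G.x_pos
  have hy := G.y_pos
  have hlt := G.lt_add
  have hsq : √3 ^ 2 = (3 : ℝ) := Real.sq_sqrt (by norm_num)
  have hinv : lam⁻¹ = 2 - √3 :=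
    inv_eq_of_mul_eq_one_right (by unfold lam; linear_combination -hsq)
  have hdiv : ∀ (c : ℝ) (j : ℕ), c / (2 * lam ^ j) = c * (2 - √3) ^ j / 2 := by
    intro c j
    rw [← hinv, inv_pow]
    ring
  simp only [hdiv, one_mul]
  have h1 := angle_gt
  have h2 := angle_lt
  unfold angle at h1 h2
  have hk : 0 < (2 - √3) ^ (k + 1) := pow_pos (by linarith) _
  have hne : x ≠ y := by
    rcases hst with ⟨rfl, rfl⟩ | ⟨rfl, rfl⟩ | ⟨rfl, rfl⟩
    · exact ne_of_gt (by nlinarith)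
    · exact ne_of_lt (by nlinarith)
    · rw [pow_succ _ (k + 1)]
      exact ne_of_gt (by nlinarith)
  refine ⟨?_, ?_, ?_⟩
  · rintro _ ⟨i, rfl⟩
    obtain ⟨j, -, h⟩ := G.exists_hasFrequency ha hb i
    rwa [h.frequency_eq]
  · rintro ⟨w, hw, hbi⟩
    rw [G.frequencySet_eq_pair ha hb (G.eq_add_of_isBispecial hn ha hb hw hbi)]
    refine ⟨⟨k, ?_⟩, Set.ncard_pair fun h => hne (by linarith)⟩
    rcases hst with ⟨rfl, rfl⟩ | ⟨rfl, rfl⟩ | ⟨rfl, rfl⟩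
    · exact Or.inl (Set.pair_comm _ _)
    · exact Or.inr (Or.inl (Set.pair_comm _ _))
    · exact Or.inr (Or.inr rfl)
  · intro hno
    have hlt' : n + 1 + 1 < a + b :=
      lt_of_le_of_ne hlt fun h => hno (G.exists_isBispecial hn ha hb h)
    rw [G.frequencySet_eq_triple ha hb hlt']
    refine ⟨⟨k, ?_⟩, Set.ncard_eq_three.2 ⟨_, _, _, ?_, ?_, ?_, rfl⟩⟩
    · rcases hst with ⟨rfl, rfl⟩ | ⟨rfl, rfl⟩ | ⟨rfl, rfl⟩
      · left
        -- Since (√3 + 1)(2 - √3) = √3 - 1, the long gap uses the exponent k rather than k + 1.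
        rw [show (√3 * (2 - √3) ^ (k + 1) + (2 - √3) ^ (k + 1)) / 2 =
          (√3 - 1) * (2 - √3) ^ k / 2 by linear_combination (-(2 - √3) ^ k / 2) * hsq]
        ext; simp only [Set.mem_insert_iff, Set.mem_singleton_iff]; tauto
      · right; left
        rw [show ((√3 - 1) * (2 - √3) ^ (k + 1) + (2 - √3) ^ (k + 1)) / 2 =
          √3 * (2 - √3) ^ (k + 1) / 2 by ring]
        ext; simp only [Set.mem_insert_iff, Set.mem_singleton_iff]; tauto
      · right; right
        rw [show ((√3 - 1) * (2 - √3) ^ (k + 1) + (2 - √3) ^ (k + 2)) / 2 =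
          (2 - √3) ^ (k + 1) / 2 by ring]
        ext; simp only [Set.mem_insert_iff, Set.mem_singleton_iff]; tauto
    · exact fun h => hne (by linarith)
    · exact fun h => by linarith
    · exact fun h => by linarith
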